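/- Fix an algebraic closure $\bar{\mathbb Q}$ of $\mathbb Q$. Let $G$ be a transitive permutation group on a finite set $\Omega$ with $|\Omega|=n$. For real $X>0$ let $N_n(X;G)$ be the number of subfields $K\subset\bar{\mathbb Q}$ with $[K:\mathbb Q]=n$ and $|\Delta_K|\le X$ such that $\mathrm{Gal}(\widetilde K/\mathbb Q)$, where $\widetilde K$ is the Galois closure of $K$, acting by composition on the $n$ embeddings of $K$ into $\bar{\mathbb Q}$, is isomorphic to $G$ as a permutation group. Let $H\subseteq G$ be the stabilizer of a point of $\Omega$, and let $N$ be the normalizer of $H$ in $G$. For $j=bH\in N/H$ let $\pi_j$ be the permutation $gH\mapsto gbH$ of $G/H$. For $\mathbf a=(a_j)_{j\in N/H}\in\mathbb Z_{\ge0}^{N/H}$ define the trace function, a polynomial in the $n$ variables $x_i$ ($i\in G/H$), $$\mathrm{Tr}_{\mathbf a}:=\sum_{i\in G/H}\ \prod_{j\in N/H}x_{\pi_j(i)}^{a_j}.$$ For a $3$-element subset $\mathcal B\subseteq N/H$ containing the identity coset, let $\mathbf a(\mathcal B)$ be the vector with entry $2$ at the identity, $1$ at the two other elements of $\mathcal B$,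 and $0$ elsewhere. **Corollary C.** Let $r\ge2$ and let $n_1,\dots,n_r\ge2$ be integers. Let $G=S_{n_1}\times\cdots\times S_{n_r}$, regarded as a permutation group on $$\Omega=[n_1]\times\cdots\times[n_{r-1}]\times S_{n_r},\qquad n:=|\Omega|=n_1\cdots n_{r-1}\cdot(n_r!),$$ where each factor $S_{n_i}$ with $i<r$ acts naturally on $[n_i]$ and the last factor acts on $S_{n_r}$ by left multiplication (the regular representation). Assume that 1. $\binom{n_r!-1}{2}\ \ge\ \Bigl(\prod_{i=1}^{r-1}n_i\Bigr)\,n_r!$, and 2. there are $n$ distinct subsets $\mathcal B_1,\dots,\mathcal B_n$ as above such that, with $f_m=\mathrm{Tr}_{\mathbf a(\mathcal B_m)}$, the Jacobian determinant $\det\left(\partial f_m/\partial x_i\right)$ is not the zero polynomial. Then $N_n(X;G)\ll X^4$, that is, there is a constant $C>0$, depending only on $n_1,\dots,n_r$, such that $N_n(X;G)$ is finite and $N_n(X;G)\le C X^4$ for all $X>0$. -/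

import Mathlib

noncomputable section

namespace NumberFieldCount

/-! ### Number fields with a prescribed Galois group -/

section Counting

/-- The Galois closure of a subfield `K` of the algebraic closure of `ℚ`. -/
abbrev galoisClosure (K : IntermediateField ℚ (AlgebraicClosure ℚ)) :
    IntermediateField ℚ (AlgebraicClosure ℚ) :=
  IntermediateField.normalClosure ℚ K (AlgebraicClosure ℚ)

/-- The Galois group of the Galois closure of `K` acts by composition on the set of embeddings
of `K` (each embedding of `K` has its image in the Galois closure). This permutation group is
isomorphic, as a permutation group, to the permutation group `G` of `Ω`: there are a group
isomorphism `φ` and a bijection `e` between the sets that are acted on, compatible with the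
two actions. -/
def HasGaloisGroup (K : IntermediateField ℚ (AlgebraicClosure ℚ)) {Ω : Type*}
    (G : Subgroup (Equiv.Perm Ω)) : Prop :=
  ∃ (φ : (galoisClosure K ≃ₐ[ℚ] galoisClosure K) ≃* G) (e : (K →ₐ[ℚ] galoisClosure K) ≃ Ω),
    ∀ (g : galoisClosure K ≃ₐ[ℚ] galoisClosure K) (σ : K →ₐ[ℚ] galoisClosure K),
      e (g.toAlgHom.comp σ) = φ g • e σ

/-- The number fields `K` (inside a fixed algebraic closure of `ℚ`) of degree `n = |Ω|`, with
absolute discriminant at most `X`, and with Galois group isomorphic to `G` as a permutation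
group. -/
def fieldsWithGroup {Ω : Type*} (G : Subgroup (Equiv.Perm Ω)) (X : ℝ) :
    Set (IntermediateField ℚ (AlgebraicClosure ℚ)) :=
  {K | ∃ _ : NumberField K, Module.finrank ℚ K = Nat.card Ω ∧
    |(NumberField.discr K : ℝ)| ≤ X ∧ HasGaloisGroup K G}

/-- The counting function `N_n(X; G)`, where `n = |Ω|`. -/
def fieldCount {Ω : Type*} (G : Subgroup (Equiv.Perm Ω)) (X : ℝ) : ℕ :=
  (fieldsWithGroup G X).ncard

end Counting

/-! ### Trace functions -/

section Trace

variable {G : Type*} [Group G] (H : Subgroup G)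

/-- The quotient `N / H`, where `N` is the normalizer of `H` in `G`. -/
abbrev NormQuot : Type _ :=
  Subgroup.normalizer (H : Set G) ⧸ H.subgroupOf (Subgroup.normalizer (H : Set G))

/-- For `j = bH` in `N / H`, the permutation `π_j` of `G / H` sends `gH` to `g b H`. -/
def cosetPerm (j : NormQuot H) (c : G ⧸ H) : G ⧸ H :=
  Quotient.liftOn₂' j c
    (fun b g => ((g * (b : G) : G) : G ⧸ H))
    (by
      intro b₁ g₁ b₂ g₂ hb hg
      rw [QuotientGroup.leftRel_apply] at hb hg
      rw [Subgroup.mem_subgroupOf] at hb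
      refine QuotientGroup.eq.mpr ?_
      have h1 : (b₁ : G)⁻¹ * (g₁⁻¹ * g₂) * b₁ ∈ H := by
        have := (Subgroup.mem_normalizer_iff.mp (inv_mem b₁.2) (g₁⁻¹ * g₂)).mp hg
        simpa using this
      have h2 := H.mul_mem h1 hb
      have h3 : (b₁ : G)⁻¹ * (g₁⁻¹ * g₂) * b₁ * ((b₁⁻¹ * b₂ : Subgroup.normalizer (H : Set G)) : G)
          = (g₁ * (b₁ : G))⁻¹ * (g₂ * (b₂ : G)) := by
        push_cast
        group
      rw [← h3]
      exact h2)

theorem cosetPerm_mk (b : Subgroup.normalizer (H : Set G)) (g : G) :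
    cosetPerm H (b : NormQuot H) (g : G ⧸ H) = ((g * (b : G) : G) : G ⧸ H) := rfl

attribute [local instance] Fintype.ofFinite

/-- The trace function `Tr_a = ∑ i, ∏ j, x_{π_j(i)} ^ a_j`, a polynomial in variables indexed by
the `n` cosets of `H`; the exponent vector `a` is indexed by `N / H`. -/
def traceFun [Finite G] (a : NormQuot H → ℕ) : MvPolynomial (G ⧸ H) ℤ :=
  ∑ i : G ⧸ H, ∏ j : NormQuot H, MvPolynomial.X (cosetPerm H j i) ^ a j

open Classical in
/-- The exponent vector of a set `B` of elements of `N / H`: it is `t` at the identity, `1` at the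
other elements of `B`, and `0` elsewhere. -/
def expVector (t : ℕ) (B : Finset (NormQuot H)) (j : NormQuot H) : ℕ :=
  if j = 1 then t else if j ∈ B then 1 else 0

/-- The `k`-element subsets of `N / H` that contain the identity. -/
def pointedSubsets (k : ℕ) : Set (Finset (NormQuot H)) :=
  {B | B.card = k ∧ 1 ∈ B}

open Classical in
/-- For some choice of `n = |G / H|` different vectors `a(B)`, with `B` a `k`-element subset of
`N / H` containing the identity, the Jacobian determinant of the trace functions is not the zero
polynomial. The chosen vectors are indexed by `G / H`, so that the Jacobian matrix is square. -/
def JacobianCondition [Finite G] (k t : ℕ) : Prop :=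
  ∃ B : (G ⧸ H) ↪ pointedSubsets H k,
    (Matrix.of fun i x : G ⧸ H =>
      MvPolynomial.pderiv x (traceFun H (expVector H t (B i)))).det ≠ 0

end Trace

/-! ### The permutation group -/

section Group

/-- The set on which `S_{n_1} × ⋯ × S_{n_{s+1}}` acts: the product of the sets `[n_i]`, for `i ≤ s`,
and of the underlying set of the group `S_{n_{s+1}}`. It has `n_1 ⋯ n_s · (n_{s+1})!` elements. -/
abbrev Points {s : ℕ} (n : Fin (s + 1) → ℕ) : Type :=
  (∀ i : Fin s, Fin (n i.castSucc)) × Equiv.Perm (Fin (n (Fin.last s)))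

/-- The natural embedding of `S_{n_1} × ⋯ × S_{n_{s+1}}` in the symmetric group of `Points n`: each
`S_{n_i}` with `i ≤ s` acts naturally on `[n_i]`, and the last factor acts on itself by left
multiplication. -/
def naturalEmbedding {s : ℕ} (n : Fin (s + 1) → ℕ) :
    (∀ i, Equiv.Perm (Fin (n i))) →* Equiv.Perm (Points n) where
  toFun g := Equiv.prodCongr (Equiv.piCongrRight fun i : Fin s => g i.castSucc)
    (Equiv.mulLeft (g (Fin.last s)))
  map_one' := by ext x <;> simp
  map_mul' g h := by ext x <;> simp

theorem naturalEmbedding_apply {s : ℕ} (n : Fin (s + 1) → ℕ) (g : ∀ i, Equiv.Perm (Fin (n i)))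
    (x : Points n) :
    naturalEmbedding n g x = (fun i => g i.castSucc (x.1 i), g (Fin.last s) * x.2) := rfl

/-- The group `S_{n_1} × ⋯ × S_{n_{s+1}}` as a permutation group of `Points n`. -/
def productGroup {s : ℕ} (n : Fin (s + 1) → ℕ) : Subgroup (Equiv.Perm (Points n)) :=
  (naturalEmbedding n).range

end Group

end NumberFieldCount

end

/-! Attach to each field `K` of degree `n` and discriminant `D`, `|D| ≤ X`, an algebraic integer `α`
generating it, whose conjugates are `O(X ^ (1/n))` and avoid the zero set of the Jacobian. The `n`
trace functions are invariant under `G` and homogeneous of degree `4`, so at the conjugates of `α`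
they take rational integer values of size `O(X ^ (4/n))`. This leaves `O(X ^ 4)` integer vectors. A
vector has boundedly many nonsingular preimages, and the coordinates of a preimage generate at most
`n` fields.

Size of `α`: let `λ_1 ≤ … ≤ λ_n` be the successive minima of the ring of integers. A dimension count
produces a product of two short integers outside the span of the first `n - 1` minimal vectors, so
`λ_n ≪ λ_k λ_{n+1-k}` (`norm_last_le_mul`). Multiplying over `k` and applying Minkowski's second
theorem, `λ_n ^ n ≪ (∏ λ_k) ^ 2 ≪ |D|`. A combination of the short basis with bounded integer
coefficients then avoids any prescribed hypersurface (`exists_small_integer_eval_ne_zero`).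

Fibres: a nonzero Jacobian makes the coordinates algebraic over the values of the map, which bounds
generic fibres. Nonsingular points persist under small changes of the target, so the bound carries
over to the nonsingular points of every fibre (`exists_nonsingular_fibre_bound`). -/

noncomputable section

namespace NumberFieldCount

/-! ### Nonsingular points of the fibres of a polynomial map -/

section Fibres

open MvPolynomial Filter Topology

variable {σ : Type*} [Fintype σ] [DecidableEq σ]

/-- The Jacobian determinant of a family of polynomials. -/
def jacobianDet {R : Type*} [CommRing R] (f : σ → MvPolynomial σ R) : MvPolynomial σ R :=
  (Matrix.of fun i x => pderiv x (f i)).det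

theorem map_jacobianDet {R S : Type*} [CommRing R] [CommRing S] (φ : R →+* S)
    (f : σ → MvPolynomial σ R) :
    jacobianDet (fun i => map φ (f i)) = map φ (jacobianDet f) := by
  rw [jacobianDet, jacobianDet, RingHom.map_det]
  congr 1
  ext1 i x
  simp [pderiv_map]

omit [DecidableEq σ] in
theorem hasStrictFDerivAt_eval (p : MvPolynomial σ ℂ) (x : σ → ℂ) :
    HasStrictFDerivAt (fun y : σ → ℂ => eval y p)
      (∑ i, eval x (pderiv i p) • (ContinuousLinearMap.proj i : (σ → ℂ) →L[ℂ] ℂ)) x := by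
  classical
  induction p using MvPolynomial.induction_on with
  | C a =>
    convert! hasStrictFDerivAt_const (𝕜 := ℂ) a x using 1
    · ext y; simp
    · ext v; simp
  | add p q hp hq =>
    convert! hp.add hq using 1
    · ext y; simp
    · ext v; simp [add_mul, Finset.sum_add_distrib]
  | mul_X p i hp =>
    have h1 := hp.mul ((ContinuousLinearMap.proj (R := ℂ) (φ := fun _ : σ => ℂ) i).hasStrictFDerivAt
      (x := x))
    convert! h1 using 1
    · ext y; simp
    · ext v
      simp only [pderiv_mul, pderiv_X, map_add, map_mul, eval_X, _root_.sum_apply,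
        _root_.smul_apply, ContinuousLinearMap.proj_apply, smul_eq_mul,
        _root_.add_apply, Finset.mul_sum, add_mul, Finset.sum_add_distrib]
      rw [add_comm]
      congr 1
      · rw [Finset.sum_eq_single i]
        · simp
        · intro b _ hb; simp [hb.symm]
        · simp
      · refine Finset.sum_congr rfl fun j _ => by ring

/-- The inverse function theorem, in the form used below: near a nonsingular point, neighbourhoods
are mapped onto neighbourhoods. -/
theorem map_nhds_eval_eq {f : σ → MvPolynomial σ ℂ} {x : σ → ℂ}
    (hx : eval x (jacobianDet f) ≠ 0) :
    Filter.map (fun y : σ → ℂ => fun i => eval y (f i)) (𝓝 x) = 𝓝 (fun i => eval x (f i)) := by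
  set A : Matrix σ σ ℂ := Matrix.of fun i j => eval x (pderiv j (f i)) with hA
  have hdet : IsUnit A.det := by
    have : eval x (jacobianDet f) = A.det := by
      rw [jacobianDet, RingHom.map_det]; rfl
    rw [← this]; exact hx.isUnit
  let e : (σ → ℂ) ≃L[ℂ] (σ → ℂ) :=
    (Matrix.toLinearEquiv' A (A.invertibleOfIsUnitDet hdet)).toContinuousLinearEquiv
  have he : HasStrictFDerivAt (fun y : σ → ℂ => fun i => eval y (f i))
      (e : (σ → ℂ) →L[ℂ] (σ → ℂ)) x := by
    rw [hasStrictFDerivAt_pi']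
    intro i
    convert! hasStrictFDerivAt_eval (f i) x using 1
    ext v
    simp [e, hA, Matrix.toLinearEquiv', Matrix.mulVec, dotProduct]
  exact he.map_nhds_eq_of_equiv

-- A polydisc is a product of infinite sets, so only the zero polynomial vanishes on it.
omit [DecidableEq σ] in
theorem exists_eval_ne_zero_of_mem_nhds {p : MvPolynomial σ ℂ} (hp : p ≠ 0) {x : σ → ℂ}
    {U : Set (σ → ℂ)} (hU : U ∈ 𝓝 x) : ∃ y ∈ U, eval y p ≠ 0 := by
  obtain ⟨ε, hε, hb⟩ := Metric.mem_nhds_iff.mp hU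
  by_contra! h
  refine hp (funext_set (fun i => Metric.ball (x i) ε)
    (fun i => infinite_of_mem_nhds (x i) (Metric.ball_mem_nhds _ hε)) fun y hy => ?_)
  rw [map_zero]
  refine h y (hb ?_)
  rw [ball_pi x hε]
  exact hy

/-- The image of the map contains a neighbourhood of the value at a nonsingular point, and an
algebraic relation would vanish on all of it. -/
theorem algebraicIndependent_of_jacobianDet_ne_zero {f : σ → MvPolynomial σ ℂ}
    (hf : jacobianDet f ≠ 0) : AlgebraicIndependent ℂ f := by
  rw [algebraicIndependent_iff]
  intro p hp
  obtain ⟨x, -, hx⟩ := exists_eval_ne_zero_of_mem_nhds hf (x := 0) univ_mem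
  by_contra hne
  have hr : Set.range (fun y : σ → ℂ => fun i => eval y (f i)) ∈ 𝓝 (fun i => eval x (f i)) := by
    rw [← map_nhds_eval_eq hx]; exact range_mem_map
  obtain ⟨_, ⟨y, rfl⟩, hy⟩ := exists_eval_ne_zero_of_mem_nhds hne hr
  refine hy ?_
  have h := congrArg (eval y) hp
  rw [map_zero, ← coe_aeval_eq_eval, ← AlgHom.coe_toRingHom] at h
  rw [← h, ← coe_aeval_eq_eval]
  simp only [RingHom.coe_coe, ← AlgHom.comp_apply]
  congr 1
  ext i
  simp

/-- Outside a proper closed subset of the target, the fibres of a generically étale polynomial map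
have bounded size. -/
theorem exists_generic_fibre_bound {f : σ → MvPolynomial σ ℂ} (hf : jacobianDet f ≠ 0) :
    ∃ (c : MvPolynomial σ ℂ) (M : ℕ), c ≠ 0 ∧ ∀ t : σ → ℂ, eval t c ≠ 0 →
      {x : σ → ℂ | ∀ i, eval x (f i) = t i}.Finite ∧
      {x : σ → ℂ | ∀ i, eval x (f i) = t i}.ncard ≤ M := by
  have hind := algebraicIndependent_of_jacobianDet_ne_zero hf
  have hbasis : IsTranscendenceBasis ℂ f :=
    hind.isTranscendenceBasis_of_lift_trdeg_le_of_finite (by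
      rw [MvPolynomial.trdeg_of_isDomain]; simp)
  have halg := hbasis.isAlgebraic
  have key : ∀ i : σ, ∃ p : Polynomial (MvPolynomial σ ℂ), p ≠ 0 ∧
      Polynomial.eval₂ (aeval f : MvPolynomial σ ℂ →ₐ[ℂ] MvPolynomial σ ℂ).toRingHom (X i) p
        = 0 := by
    intro i
    obtain ⟨q, hq, hq0⟩ := halg.isAlgebraic (X i : MvPolynomial σ ℂ)
    refine ⟨q.map (hind.aevalEquiv.symm : _ →+* MvPolynomial σ ℂ), ?_, ?_⟩
    · rwa [Ne, Polynomial.map_eq_zero_iff]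
      exact hind.aevalEquiv.symm.injective
    · rw [Polynomial.eval₂_map, ← hq0, Polynomial.aeval_def]
      congr 1
      ext1 a
      obtain ⟨b, rfl⟩ := hind.aevalEquiv.surjective a
      simp
  choose p hp0 hp using key
  -- If no leading coefficient vanishes at `t`, each coordinate of a point over `t` is a root of a
  -- nonzero polynomial of bounded degree.
  refine ⟨∏ i, (p i).leadingCoeff, ∏ i, (p i).natDegree,
    Finset.prod_ne_zero_iff.mpr fun i _ => by simpa using hp0 i, fun t ht => ?_⟩
  rw [map_prod, Finset.prod_ne_zero_iff] at ht
  have hne : ∀ i, (p i).map (eval t) ≠ 0 := fun i =>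
    fun h => ht i (Finset.mem_univ i) (by
      have := congrArg (Polynomial.coeff · (p i).natDegree) h
      simpa [Polynomial.coeff_map] using this)
  have hsub : {x : σ → ℂ | ∀ i, eval x (f i) = t i} ⊆
      (Fintype.piFinset fun i => ((p i).map (eval t)).roots.toFinset : Finset (σ → ℂ)) := by
    intro x hx
    rw [Finset.mem_coe, Fintype.mem_piFinset]
    intro i
    rw [Multiset.mem_toFinset, Polynomial.mem_roots (hne i), Polynomial.IsRoot.def,
      Polynomial.eval_map]
    have h := congrArg (eval x) (hp i)
    rw [map_zero, Polynomial.hom_eval₂, eval_X] at h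
    rw [← h]
    congr 1
    refine MvPolynomial.ringHom_ext (fun a => by simp) fun j => ?_
    simpa using (hx j).symm
  refine ⟨(Finset.finite_toSet _).subset hsub, ?_⟩
  refine (Set.ncard_le_ncard hsub (Finset.finite_toSet _)).trans ?_
  rw [Set.ncard_coe_finset, Fintype.card_piFinset]
  refine Finset.prod_le_prod' fun i _ => ?_
  exact (Multiset.toFinset_card_le _).trans
    ((Polynomial.card_roots' _).trans (Polynomial.natDegree_map_le))

/-- The number of nonsingular points in the fibres of a polynomial map is bounded. -/
theorem exists_nonsingular_fibre_bound (f : σ → MvPolynomial σ ℂ) :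
    ∃ M : ℕ, ∀ t : σ → ℂ,
      {x : σ → ℂ | (∀ i, eval x (f i) = t i) ∧ eval x (jacobianDet f) ≠ 0}.Finite ∧
      {x : σ → ℂ | (∀ i, eval x (f i) = t i) ∧ eval x (jacobianDet f) ≠ 0}.ncard ≤ M := by
  by_cases hf : jacobianDet f = 0
  · exact ⟨0, fun t => by simp [hf]⟩
  obtain ⟨c, M, hc, hM⟩ := exists_generic_fibre_bound hf
  refine ⟨M, fun t => ?_⟩
  set S := {x : σ → ℂ | (∀ i, eval x (f i) = t i) ∧ eval x (jacobianDet f) ≠ 0} with hS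
  have hfin : ∀ A : Finset (σ → ℂ), (A : Set (σ → ℂ)) ⊆ S → A.card ≤ M := by
    intro A hA
    -- Disjoint neighbourhoods of the points of `A` all have images that are neighbourhoods of `t`.
    -- A generic `t'` in their intersection has a preimage near each point, so its fibre is at least
    -- as large as `A`.
    obtain ⟨U, hU, hdisj⟩ := (A.finite_toSet).t2_separation
    have hW : (⋂ x ∈ A, (fun y : σ → ℂ => fun i => eval y (f i)) '' U x) ∈ 𝓝 t := by
      rw [Filter.biInter_finset_mem]
      intro x hx
      have h1 := map_nhds_eval_eq (hA hx).2
      rw [show (fun i => eval x (f i)) = t from funext (hA hx).1] at h1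
      rw [← h1]
      exact image_mem_map ((hU x).2.mem_nhds (hU x).1)
    obtain ⟨t', ht', hct⟩ := exists_eval_ne_zero_of_mem_nhds hc hW
    rw [Set.mem_iInter₂] at ht'
    choose! g hg using ht'
    rw [← Set.ncard_coe_finset A]
    refine le_trans ?_ (hM t' hct).2
    refine Set.ncard_le_ncard_of_injOn g (fun x hx i => congrFun (hg x hx).2 i) ?_ (hM t' hct).1
    intro x hx y hy hxy
    by_contra hne
    exact Set.disjoint_left.mp (hdisj hx hy hne) (hg x hx).1 (hxy ▸ (hg y hy).1)
  have hSf : S.Finite := by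
    by_contra hinf
    obtain ⟨A, hA, hcard⟩ := Set.Infinite.exists_subset_card_eq hinf (M + 1)
    have := hfin A hA
    omega
  refine ⟨hSf, ?_⟩
  rw [Set.ncard_eq_toFinset_card S hSf]
  exact hfin _ (by simp)

end Fibres

/-! ### Successive minima of a lattice in a Euclidean space -/

section Minkowski

open Module Submodule MeasureTheory

variable {E : Type*} [NormedAddCommGroup E] [InnerProductSpace ℝ E] [FiniteDimensional ℝ E]
  (L : Submodule ℤ E) [DiscreteTopology L] [IsZLattice ℝ L]

theorem exists_shortest_notMem (W : Submodule ℝ E) (hW : W ≠ ⊤) :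
    ∃ v ∈ L, v ∉ W ∧ ∀ x ∈ L, x ∉ W → ‖v‖ ≤ ‖x‖ := by
  obtain ⟨x₀, hx₀L, hx₀W⟩ : ∃ x ∈ L, x ∉ W := by
    by_contra! h
    refine hW (top_le_iff.mp ?_)
    rw [← IsZLattice.span_top (K := ℝ) (L := L)]
    exact span_le.mpr h
  have hfin : (Metric.closedBall (0 : E) ‖x₀‖ ∩ (L : Set E)).Finite := by
    change ((_ : Set E) ∩ L.toAddSubgroup).Finite
    have : DiscreteTopology L.toAddSubgroup := (inferInstance : DiscreteTopology L)
    exact Metric.finite_isBounded_inter_isClosed DiscreteTopology.isDiscrete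
      Metric.isBounded_closedBall inferInstance
  obtain ⟨v, ⟨⟨hvb, hvL⟩, hvW⟩, hv⟩ := Set.exists_min_image
    ((Metric.closedBall (0 : E) ‖x₀‖ ∩ (L : Set E)) \ W) (fun x => ‖x‖) hfin.sdiff
    ⟨x₀, ⟨by simp, hx₀L⟩, hx₀W⟩
  refine ⟨v, hvL, hvW, fun x hxL hxW => ?_⟩
  by_cases hx : ‖x‖ ≤ ‖x₀‖
  · exact hv x ⟨⟨by simpa using hx, hxL⟩, hxW⟩
  · exact le_trans (by simpa using hvb) (not_le.mp hx).le

/-- Successive minima: a basis of the space consisting of lattice vectors, each of which is a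
shortest lattice vector outside the span of its predecessors. -/
theorem exists_successive_minima :
    ∃ v : Fin (finrank ℝ E) → E, (∀ i, v i ∈ L) ∧ LinearIndependent ℝ v ∧
      ∀ i, ∀ x ∈ L, x ∉ span ℝ (v '' Set.Iio i) → ‖v i‖ ≤ ‖x‖ := by
  classical
  choose! f hfL hfW hf using exists_shortest_notMem L
  let W (k : ℕ) : Submodule ℝ E := (fun W => W ⊔ ℝ ∙ f W)^[k] ⊥
  have hsucc : ∀ k, W (k + 1) = W k ⊔ ℝ ∙ f (W k) := fun k => Function.iterate_succ_apply' _ _ _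
  have hrank : ∀ k ≤ finrank ℝ E, finrank ℝ (W k) = k := by
    intro k
    induction k with
    | zero => intro _; exact finrank_bot ℝ E
    | succ k ih =>
      intro hk
      have h1 := ih (by omega)
      have hne : W k ≠ ⊤ := by
        intro h
        rw [h, finrank_top] at h1
        omega
      rw [hsucc, Submodule.finrank_sup_span_singleton (hfW _ hne), h1]
  have hne : ∀ k < finrank ℝ E, W k ≠ ⊤ := by
    intro k hk h
    have h1 := hrank k hk.le
    rw [h, finrank_top] at h1
    omega
  have hspan : ∀ k, span ℝ ((fun j => f (W j)) '' Set.Iio k) = W k := by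
    intro k
    induction k with
    | zero => simp [W]
    | succ k ih =>
      rw [hsucc, show Set.Iio (k + 1) = insert k (Set.Iio k) by ext; simp,
        Set.image_insert_eq, span_insert, sup_comm, ih]
  refine ⟨fun i => f (W i), fun i => hfL _ (hne i i.2), ?_, fun i x hx hxW => ?_⟩
  · refine linearIndependent_of_top_le_span_of_card_eq_finrank ?_ (by simp)
    have h := hspan (finrank ℝ E)
    rw [eq_top_of_finrank_eq (hrank _ le_rfl)] at h
    rw [← h]
    refine span_mono ?_
    rintro _ ⟨j, hj, rfl⟩
    exact ⟨⟨j, hj⟩, rfl⟩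
  · refine hf _ (hne i i.2) x hx fun hmem => hxW ?_
    rw [← hspan i] at hmem
    refine span_mono ?_ hmem
    rintro _ ⟨j, hj, rfl⟩
    exact ⟨⟨j, lt_trans hj i.2⟩, hj, rfl⟩

variable {L}

omit [FiniteDimensional ℝ E] [DiscreteTopology L] [IsZLattice ℝ L] in
theorem norm_mono_of_successive_minima {n : ℕ} {v : Fin n → E} (hvL : ∀ i, v i ∈ L)
    (hv : LinearIndependent ℝ v)
    (hmin : ∀ i, ∀ x ∈ L, x ∉ span ℝ (v '' Set.Iio i) → ‖v i‖ ≤ ‖x‖) :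
    Monotone fun i => ‖v i‖ := by
  intro i j hij
  exact hmin i _ (hvL j) (hv.notMem_span_image (by simpa using hij))

variable [MeasurableSpace E] [BorelSpace E]

/-- The upper bound in Minkowski's second theorem, for a Euclidean norm. -/
theorem prod_norm_successive_minima_le {v : Fin (finrank ℝ E) → E} (hvL : ∀ i, v i ∈ L)
    (hv : LinearIndependent ℝ v)
    (hmin : ∀ i, ∀ x ∈ L, x ∉ span ℝ (v '' Set.Iio i) → ‖v i‖ ≤ ‖x‖) :
    (∏ i, ‖v i‖) * volume.real (Metric.ball (0 : E) 1) ≤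
      2 ^ finrank ℝ E * ZLattice.covolume L := by
  classical
  have hmono := norm_mono_of_successive_minima hvL hv hmin
  have hcard : finrank ℝ E = Fintype.card (Fin (finrank ℝ E)) := by simp
  let b := InnerProductSpace.gramSchmidtOrthonormalBasis hcard v
  -- The ellipsoid with semi-axes `‖v i‖` along the Gram–Schmidt directions. It contains no nonzero
  -- lattice point, so Minkowski's convex body theorem bounds its volume.
  let A : E →ₗ[ℝ] E := Matrix.toLin b.toBasis b.toBasis (Matrix.diagonal fun i => ‖v i‖)
  have hA : ∀ y i, b.repr (A y) i = ‖v i‖ * b.repr y i := by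
    intro y i
    have := congrFun (LinearMap.toMatrix_mulVec_repr b.toBasis b.toBasis A y) i
    simpa [A, LinearMap.toMatrix_toLin, Matrix.mulVec_diagonal] using this.symm
  have hdet : LinearMap.det A = ∏ i, ‖v i‖ := by
    rw [LinearMap.det_toLin, Matrix.det_diagonal]
  have hpos : 0 ≤ ∏ i, ‖v i‖ := Finset.prod_nonneg fun i _ => norm_nonneg _
  have hno : ∀ x ∈ L, x ≠ 0 → x ∉ A '' Metric.ball 0 1 := by
    rintro x hx hx0 ⟨y, hy, rfl⟩
    have hne : (Finset.univ.filter fun i => b.repr (A y) i ≠ 0).Nonempty := by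
      by_contra h
      rw [Finset.not_nonempty_iff_eq_empty, Finset.filter_eq_empty_iff] at h
      refine hx0 (b.repr.injective ?_)
      ext i
      simpa using h (Finset.mem_univ i)
    -- The last nonzero coordinate puts the lattice point outside the span of the `v i` with `i <
    -- k`, so its norm is at least `‖v k‖`. But only semi-axes of length at most `‖v k‖` contribute,
    -- which makes the norm smaller than `‖v k‖`.
    set k := Finset.max' _ hne with hk
    have hk0 : b.repr (A y) k ≠ 0 := (Finset.mem_filter.mp (Finset.max'_mem _ hne)).2
    have hgt : ∀ i, k < i → b.repr (A y) i = 0 := by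
      intro i hi
      by_contra h
      exact absurd (Finset.le_max' _ i (Finset.mem_filter.mpr ⟨Finset.mem_univ i, h⟩))
        (not_le.mpr hi)
    have hle : ‖v k‖ ≤ ‖A y‖ := by
      refine hmin k _ hx fun hmem => hk0 ?_
      have hker : span ℝ (v '' Set.Iio k) ≤ LinearMap.ker (b.toBasis.coord k) := by
        rw [span_le]
        rintro _ ⟨i, hi, rfl⟩
        simpa using! InnerProductSpace.gramSchmidtOrthonormalBasis_inv_triangular' hcard v hi
      simpa using hker hmem
    have hlt : ‖A y‖ ^ 2 < ‖v k‖ ^ 2 := by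
      have hvk : 0 < ‖v k‖ := norm_pos_iff.mpr (hv.ne_zero k)
      calc ‖A y‖ ^ 2 = ∑ i, (b.repr (A y) i) ^ 2 := by
            rw [← b.repr.norm_map (A y), EuclideanSpace.norm_sq_eq]
            simp
        _ ≤ ∑ i, ‖v k‖ ^ 2 * (b.repr y i) ^ 2 := by
            refine Finset.sum_le_sum fun i _ => ?_
            rcases lt_or_ge k i with h | h
            · rw [hgt i h, zero_pow two_ne_zero]; positivity
            · rw [hA, mul_pow]
              have := hmono h
              simp only at this
              gcongr
        _ = ‖v k‖ ^ 2 * ‖y‖ ^ 2 := by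
            rw [← Finset.mul_sum, ← b.repr.norm_map y, EuclideanSpace.norm_sq_eq]
            simp
        _ < ‖v k‖ ^ 2 := by
            have : ‖y‖ < 1 := by simpa using hy
            have h2 : ‖y‖ ^ 2 < 1 := by
              rw [sq_lt_one_iff₀ (norm_nonneg _)]; exact this
            nlinarith [sq_pos_of_pos hvk]
    exact absurd hle (not_le.mpr (lt_of_pow_lt_pow_left₀ 2 (norm_nonneg _) hlt))
  by_contra! hlt
  let B := Free.chooseBasis ℤ L
  have hfund := ZLattice.isAddFundamentalDomain B (volume : Measure E)
  set F := ZSpan.fundamentalDomain (B.ofZLatticeBasis ℝ) with hF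
  have hFfin : volume F ≠ ⊤ :=
    (Bornology.IsBounded.measure_lt_top (ZSpan.fundamentalDomain_isBounded _)).ne
  rw [ZLattice.covolume_eq_measure_fundamentalDomain L volume hfund] at hlt
  have hvol : volume F * 2 ^ finrank ℝ E < volume (A '' Metric.ball 0 1) := by
    rw [Measure.addHaar_image_linearMap, hdet, abs_of_nonneg hpos]
    rw [← ENNReal.ofReal_toReal hFfin,
      ← ENNReal.ofReal_toReal (measure_ball_lt_top (μ := volume) (x := (0 : E)) (r := 1)).ne,
      show (2 : ENNReal) = ENNReal.ofReal 2 by simp, ← ENNReal.ofReal_pow (by norm_num),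
      ← ENNReal.ofReal_mul (by positivity), ← ENNReal.ofReal_mul hpos, mul_comm (volume F).toReal]
    exact (ENNReal.ofReal_lt_ofReal_iff_of_nonneg (by positivity)).mpr hlt
  have hfund' : IsAddFundamentalDomain L.toAddSubgroup F (volume : Measure E) := hfund
  have : Countable L.toAddSubgroup := inferInstanceAs (Countable L)
  obtain ⟨x, hx0, hx⟩ := exists_ne_zero_mem_lattice_of_measure_mul_two_pow_lt_measure hfund'
    (s := A '' Metric.ball 0 1)
    (by rintro _ ⟨y, hy, rfl⟩; exact ⟨-y, by simpa using hy, by simp⟩)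
    ((convex_ball 0 1).linear_image A) hvol
  exact hno x x.2 (by simpa using hx0) hx

theorem exists_minkowski_reduced_family (L : Submodule ℤ E) [DiscreteTopology L] [IsZLattice ℝ L]
    {n : ℕ} (hn : finrank ℝ E = n) :
    ∃ v : Fin n → E, (∀ i, v i ∈ L) ∧ LinearIndependent ℝ v ∧ (Monotone fun i => ‖v i‖) ∧
      (∀ i, ∀ x ∈ L, x ∉ span ℝ (v '' Set.Iio i) → ‖v i‖ ≤ ‖x‖) ∧
      (∏ i, ‖v i‖) * volume.real (Metric.ball (0 : E) 1) ≤ 2 ^ n * ZLattice.covolume L := by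
  subst hn
  obtain ⟨v, hvL, hv, hmin⟩ := exists_successive_minima L
  exact ⟨v, hvL, hv, norm_mono_of_successive_minima hvL hv hmin, hmin,
    prod_norm_successive_minima_le hvL hv hmin⟩

end Minkowski

/-! ### Short integral bases of number fields -/

section ShortBasis

open Module Submodule NumberField NumberField.mixedEmbedding NumberField.InfinitePlace
  MeasureTheory

open scoped Classical

variable (K : Type*) [Field K] [NumberField K]

/-- The embedding of a number field in its Euclidean mixed space. -/
def euclideanEmbedding : K →ₗ[ℚ] euclidean.mixedSpace K :=
  ((euclidean.toMixed K).symm.toLinearMap.toAddMonoidHom.comp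
    (mixedEmbedding K).toAddMonoidHom).toRatLinearMap

variable {K}

theorem toMixed_euclideanEmbedding (x : K) :
    euclidean.toMixed K (euclideanEmbedding K x) = mixedEmbedding K x :=
  (euclidean.toMixed K).apply_symm_apply _

theorem euclideanEmbedding_mem_integerLattice (x : 𝓞 K) :
    euclideanEmbedding K x ∈ euclidean.integerLattice K := by
  change euclidean.toMixed K (euclideanEmbedding K x) ∈ mixedEmbedding.integerLattice K
  rw [toMixed_euclideanEmbedding]
  exact ⟨x, by simp⟩

theorem exists_of_mem_integerLattice {v : euclidean.mixedSpace K}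
    (hv : v ∈ euclidean.integerLattice K) : ∃ x : 𝓞 K, euclideanEmbedding K x = v := by
  obtain ⟨x, hx⟩ : euclidean.toMixed K v ∈ mixedEmbedding.integerLattice K := hv
  refine ⟨x, (euclidean.toMixed K).injective ?_⟩
  rw [toMixed_euclideanEmbedding, ← hx]
  simp

theorem norm_sq_euclideanEmbedding (x : K) :
    ‖euclideanEmbedding K x‖ ^ 2 =
      (∑ w : {w : InfinitePlace K // IsReal w}, w.1 x ^ 2) +
        ∑ w : {w : InfinitePlace K // IsComplex w}, w.1 x ^ 2 := by
  rw [WithLp.prod_norm_sq_eq_of_L2, EuclideanSpace.norm_sq_eq, EuclideanSpace.norm_sq_eq]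
  have h1 : ∀ w : {w : InfinitePlace K // IsReal w},
      (euclideanEmbedding K x).fst w = (mixedEmbedding K x).1 w := fun w => by
    rw [← toMixed_euclideanEmbedding]; rfl
  have h2 : ∀ w : {w : InfinitePlace K // IsComplex w},
      (euclideanEmbedding K x).snd w = (mixedEmbedding K x).2 w := fun w => by
    rw [← toMixed_euclideanEmbedding]; rfl
  congr 1
  · refine Finset.sum_congr rfl fun w _ => ?_
    rw [h1, ← normAtPlace_apply_of_isReal w.2, normAtPlace_apply]
  · refine Finset.sum_congr rfl fun w _ => ?_
    rw [h2, ← normAtPlace_apply_of_isComplex w.2, normAtPlace_apply]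

theorem house_le_norm_euclideanEmbedding (x : K) : house x ≤ ‖euclideanEmbedding K x‖ := by
  rw [house, pi_norm_le_iff_of_nonneg (norm_nonneg _)]
  intro φ
  rw [canonicalEmbedding.apply_at, ← InfinitePlace.apply φ x]
  refine le_of_sq_le_sq ?_ (norm_nonneg _)
  rw [norm_sq_euclideanEmbedding]
  have hr : 0 ≤ ∑ w : {w : InfinitePlace K // IsReal w}, w.1 x ^ 2 :=
    Finset.sum_nonneg fun _ _ => sq_nonneg _
  have hc : 0 ≤ ∑ w : {w : InfinitePlace K // IsComplex w}, w.1 x ^ 2 :=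
    Finset.sum_nonneg fun _ _ => sq_nonneg _
  rcases isReal_or_isComplex (InfinitePlace.mk φ) with h | h
  · have := Finset.single_le_sum (f := fun w : {w : InfinitePlace K // IsReal w} => w.1 x ^ 2)
      (fun _ _ => sq_nonneg _) (Finset.mem_univ ⟨_, h⟩)
    simp only at this
    linarith
  · have := Finset.single_le_sum (f := fun w : {w : InfinitePlace K // IsComplex w} => w.1 x ^ 2)
      (fun _ _ => sq_nonneg _) (Finset.mem_univ ⟨_, h⟩)
    simp only at this
    linarith

/-- There are at most `n` infinite places, each contributing at most the square of the house. -/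
theorem norm_euclideanEmbedding_le (x : K) :
    ‖euclideanEmbedding K x‖ ≤ √(finrank ℚ K) * house x := by
  refine le_of_sq_le_sq ?_ (mul_nonneg (Real.sqrt_nonneg _) (house_nonneg x))
  have hw : ∀ w : InfinitePlace K, w x ^ 2 ≤ house x ^ 2 := fun w => by
    rw [← norm_embedding_eq]
    gcongr
    exact norm_embedding_le_house x _
  rw [norm_sq_euclideanEmbedding, mul_pow, Real.sq_sqrt (Nat.cast_nonneg _)]
  have h1 := Finset.sum_le_card_nsmul Finset.univ
    (fun w : {w : InfinitePlace K // IsReal w} => w.1 x ^ 2) _ fun w _ => hw w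
  have h2 := Finset.sum_le_card_nsmul Finset.univ
    (fun w : {w : InfinitePlace K // IsComplex w} => w.1 x ^ 2) _ fun w _ => hw w
  refine (add_le_add h1 h2).trans ?_
  rw [← add_nsmul, nsmul_eq_mul]
  gcongr
  have := card_add_two_mul_card_eq_rank K
  rw [nrRealPlaces, nrComplexPlaces] at this
  simp only [Finset.card_univ]
  omega

/-- The covolume is `2 ^ (-r₂) * √|D|`, with `r₂` the number of complex places. -/
theorem covolume_sq_le :
    ZLattice.covolume (euclidean.integerLattice K) ^ 2 ≤ |(discr K : ℝ)| := by
  rw [euclidean.integerLattice, ZLattice.covolume_comap _ _ _ (euclidean.volumePreserving_toMixed K),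
    covolume_integerLattice, mul_pow, ← pow_mul, Real.sq_sqrt (by positivity)]
  exact mul_le_of_le_one_left (by positivity) (pow_le_one₀ (by norm_num) (by norm_num))

/-- For a nonzero functional `φ` on a field extension, the form `(x, y) ↦ φ (x * y)` does not
vanish on the product of two sets whose spans have dimensions adding up to more than the degree. -/
theorem exists_apply_mul_ne_zero {F L : Type*} [Field F] [Field L] [Algebra F L]
    [FiniteDimensional F L] {φ : L →ₗ[F] F} (hφ : φ ≠ 0) (S T : Set L)
    (h : finrank F L < finrank F (span F S) + finrank F (span F T)) :
    ∃ x ∈ S, ∃ y ∈ T, φ (x * y) ≠ 0 := by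
  by_contra! hST
  let B : L →ₗ[F] Dual F L := (LinearMap.compRight F φ).comp (LinearMap.mul F L).flip
  have hB : ∀ x y, B y x = φ (x * y) := fun x y => rfl
  have hinj : Function.Injective B := by
    rw [injective_iff_map_eq_zero]
    intro y hy
    by_contra hy0
    refine hφ (LinearMap.ext fun z => ?_)
    have := LinearMap.congr_fun hy (z * y⁻¹)
    rwa [hB, inv_mul_cancel_right₀ hy0] at this
  -- If all products were killed, `B` would embed the span of `T` in the annihilator of the span of
  -- `S`, whose dimension is too small.
  have hle : (span F T).map B ≤ (span F S).dualAnnihilator := by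
    rw [map_span, span_le]
    rintro _ ⟨y, hy, rfl⟩
    rw [SetLike.mem_coe, mem_dualAnnihilator]
    have hker : span F S ≤ LinearMap.ker (B y) := span_le.mpr fun x hx => hST x hx y hy
    exact fun x hx => hker hx
  have h1 := Submodule.finrank_mono hle
  rw [← (Submodule.equivMapOfInjective B hinj _).finrank_eq] at h1
  have h2 := Subspace.finrank_add_finrank_dualAnnihilator_eq (span F S)
  omega

/-- The top successive minimum of the ring of integers is bounded in terms of pairs of complementary
successive minima. -/
theorem norm_last_le_mul {n : ℕ} (hn : finrank ℚ K = n) {a : Fin n → 𝓞 K}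
    (hlin : LinearIndependent ℝ fun i => euclideanEmbedding K (a i))
    (hmono : Monotone fun i => ‖euclideanEmbedding K (a i)‖) (l : Fin n)
    (hmin : ∀ x : 𝓞 K, euclideanEmbedding K x ∉
      span ℝ ((fun i => euclideanEmbedding K (a i)) '' Set.Iio l) →
        ‖euclideanEmbedding K (a l)‖ ≤ ‖euclideanEmbedding K x‖) (k : Fin n) :
    ‖euclideanEmbedding K (a l)‖ ≤
      √n * (‖euclideanEmbedding K (a k)‖ * ‖euclideanEmbedding K (a k.rev)‖) := by
  have : Nonempty (Fin n) := ⟨l⟩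
  have hlinQ : LinearIndependent ℚ fun i => (a i : K) :=
    LinearIndependent.of_comp (euclideanEmbedding K) (hlin.restrict_scalars' ℚ)
  let b := basisOfLinearIndependentOfCardEqFinrank hlinQ (by simp [hn])
  have hb : ∀ i, b i = a i := fun i => by simp [b]
  let c := basisOfLinearIndependentOfCardEqFinrank hlin (by simp [euclidean.finrank, hn])
  have hc : ∀ i, c i = euclideanEmbedding K (a i) := fun i => by simp [c]
  -- The real coordinates of an embedded field element are its rational coordinates in the matching
  -- basis, so a dimension count over `ℚ` detects the real span.
  have hcoord : ∀ x, c.coord l (euclideanEmbedding K x) = b.coord l x := by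
    intro x
    conv_lhs => rw [← b.sum_repr x]
    rw [map_sum, map_sum, Finset.sum_eq_single l]
    · rw [map_smul, hb, ← hc, map_rat_smul]
      simp [Rat.smul_def]
    · intro i _ hi
      rw [map_smul, hb, ← hc, map_rat_smul]
      simp [hi]
    · simp
  have hφ : b.coord l ≠ 0 := by
    intro h
    simpa using LinearMap.congr_fun h (b l)
  have hdim : ∀ j : Fin n,
      finrank ℚ (span ℚ (Set.range fun i : Finset.Iic j => (a i : K))) = j + 1 := by
    intro j
    exact (finrank_span_eq_card (hlinQ.comp _ Subtype.val_injective)).trans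
      (by rw [Fintype.card_coe, Fin.card_Iic])
  -- The two spans have dimensions `k + 1` and `n - k`, which add up to `n + 1`.
  obtain ⟨_, ⟨i, rfl⟩, _, ⟨j, rfl⟩, hij⟩ := exists_apply_mul_ne_zero hφ
    (Set.range fun i : Finset.Iic k => (a i : K)) (Set.range fun i : Finset.Iic k.rev => (a i : K))
    (by rw [hdim, hdim, hn, Fin.val_rev]; omega)
  have hi : ‖euclideanEmbedding K (a i)‖ ≤ ‖euclideanEmbedding K (a k)‖ :=
    hmono (Finset.mem_Iic.mp i.2)
  have hj : ‖euclideanEmbedding K (a j)‖ ≤ ‖euclideanEmbedding K (a k.rev)‖ :=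
    hmono (Finset.mem_Iic.mp j.2)
  calc ‖euclideanEmbedding K (a l)‖
      ≤ ‖euclideanEmbedding K ((a i * a j : 𝓞 K) : K)‖ := by
        refine hmin _ fun hmem => hij ?_
        have hker : span ℝ ((fun i => euclideanEmbedding K (a i)) '' Set.Iio l) ≤
            LinearMap.ker (c.coord l) := by
          rw [span_le]
          rintro _ ⟨m, hm, rfl⟩
          simp [← hc, (Set.mem_Iio.mp hm).ne]
        have h0 : c.coord l (euclideanEmbedding K ((a i * a j : 𝓞 K) : K)) = 0 := hker hmem
        rw [hcoord] at h0
        simpa using h0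
    _ ≤ √n * house ((a i : K) * a j) := by
        simpa [hn] using norm_euclideanEmbedding_le ((a i * a j : 𝓞 K) : K)
    _ ≤ √n * (house (a i : K) * house (a j : K)) := by
        gcongr
        exact house_mul_le _ _
    _ ≤ √n * (‖euclideanEmbedding K (a k)‖ * ‖euclideanEmbedding K (a k.rev)‖) := by
        have h1 := (house_le_norm_euclideanEmbedding (a i : K)).trans hi
        have h2 := (house_le_norm_euclideanEmbedding (a j : K)).trans hj
        have h3 := house_nonneg (a j : K)
        gcongr

/-- A number field of degree `n` and discriminant `D` has a basis of algebraic integers whose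
conjugates are `O(|D| ^ (1 / n))`. -/
theorem exists_basis_house_pow_le (n : ℕ) : ∃ C : ℝ, 0 < C ∧
    ∀ (K : Type) [Field K] [NumberField K], finrank ℚ K = n →
      ∃ a : Fin n → 𝓞 K, LinearIndependent ℚ (fun i => (a i : K)) ∧
        ∀ i, house (a i : K) ^ n ≤ C * |(discr K : ℝ)| := by
  set β : ℝ := √Real.pi ^ n / Real.Gamma (n / 2 + 1) with hβ
  have hβ0 : 0 < β := div_pos (by positivity) (Real.Gamma_pos_of_pos (by positivity))
  rcases Nat.eq_zero_or_pos n with rfl | hn0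
  · exact ⟨1, one_pos, fun K _ _ hn => absurd hn finrank_pos.ne'⟩
  refine ⟨√n ^ n * (2 ^ n / β) ^ 2, by positivity, fun K _ _ hn => ?_⟩
  have hE : finrank ℝ (euclidean.mixedSpace K) = n := by rw [euclidean.finrank, hn]
  obtain ⟨v, hvL, hv, hmono, hmin, hprod⟩ :=
    exists_minkowski_reduced_family (euclidean.integerLattice K) hE
  choose a ha using fun i => exists_of_mem_integerLattice (hvL i)
  obtain rfl : (fun i => euclideanEmbedding K (a i)) = v := funext ha
  have hlin : LinearIndependent ℚ fun i => (a i : K) :=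
    LinearIndependent.of_comp (euclideanEmbedding K) (hv.restrict_scalars' ℚ)
  refine ⟨a, hlin, fun i => ?_⟩
  let l : Fin n := ⟨n - 1, by omega⟩
  set P := ∏ i, ‖euclideanEmbedding K (a i)‖ with hP
  have hP0 : 0 ≤ P := Finset.prod_nonneg fun i _ => norm_nonneg _
  have hball : volume.real (Metric.ball (0 : euclidean.mixedSpace K) 1) = β := by
    rw [measureReal_def, InnerProductSpace.volume_ball, hE]
    simpa [hβ] using hβ0.le
  rw [hball] at hprod
  have hP2 : P ≤ 2 ^ n / β * ZLattice.covolume (euclidean.integerLattice K) := by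
    rw [div_mul_eq_mul_div, le_div_iff₀ hβ0]
    exact hprod
  calc house (a i : K) ^ n ≤ ‖euclideanEmbedding K (a l)‖ ^ n := by
        have h1 := house_le_norm_euclideanEmbedding (a i : K)
        have h2 : ‖euclideanEmbedding K (a i)‖ ≤ ‖euclideanEmbedding K (a l)‖ :=
          hmono (show i ≤ l from Fin.le_def.mpr (Nat.le_sub_one_of_lt i.2))
        have h3 := house_nonneg (a i : K)
        gcongr
        exact h1.trans h2
    _ = ∏ _k : Fin n, ‖euclideanEmbedding K (a l)‖ := by simp
    -- One inequality for each `k`; as `k ↦ k.rev` is a permutation, every minimum occurs twice and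
    -- the product is `P * P`.
    _ ≤ ∏ k : Fin n, √n * (‖euclideanEmbedding K (a k)‖ * ‖euclideanEmbedding K (a k.rev)‖) :=
        Finset.prod_le_prod (fun _ _ => norm_nonneg _) fun k _ =>
          norm_last_le_mul hn hv hmono l
            (fun x => hmin l _ (euclideanEmbedding_mem_integerLattice x)) k
    _ = √n ^ n * (P * P) := by
        rw [Finset.prod_mul_distrib, Finset.prod_mul_distrib, Finset.prod_const, Finset.card_univ,
          Fintype.card_fin]
        congr 2
        exact Equiv.prod_comp Fin.revPerm fun k => ‖euclideanEmbedding K (a k)‖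
    _ ≤ √n ^ n * ((2 ^ n / β) ^ 2 * |(discr K : ℝ)|) := by
        refine mul_le_mul_of_nonneg_left ?_ (by positivity)
        rw [← sq]
        refine (pow_le_pow_left₀ hP0 hP2 2).trans ?_
        rw [mul_pow]
        exact mul_le_mul_of_nonneg_left covolume_sq_le (by positivity)
    _ = √n ^ n * (2 ^ n / β) ^ 2 * |(discr K : ℝ)| := by ring

end ShortBasis

/-! ### Small integers in general position -/

section GeneralPosition

open Module NumberField

variable {ι : Type*} [Fintype ι]

theorem totalDegree_aeval_le {κ R : Type*} [CommRing R] (Q : MvPolynomial ι R)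
    (g : ι → MvPolynomial κ R) (hg : ∀ i, (g i).totalDegree ≤ 1) :
    (MvPolynomial.aeval g Q).totalDegree ≤ Q.totalDegree := by
  rw [MvPolynomial.aeval_def, MvPolynomial.eval₂_eq']
  refine MvPolynomial.totalDegree_finsetSum_le fun d hd => ?_
  refine (MvPolynomial.totalDegree_mul _ _).trans ?_
  rw [MvPolynomial.algebraMap_eq, MvPolynomial.totalDegree_C, zero_add]
  refine (MvPolynomial.totalDegree_finsetProd _ _).trans ?_
  refine le_trans (Finset.sum_le_sum fun i _ => ?_)
    ((Finsupp.sum_fintype d (fun _ e => e) fun _ => rfl).symm.trans_le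
      (MvPolynomial.le_totalDegree hd))
  exact (MvPolynomial.totalDegree_pow _ _).trans (mul_le_of_le_one_right (Nat.zero_le _) (hg i))

/-- The matrix of all the conjugates of the members of a basis is invertible. -/
theorem isUnit_embeddings_matrix [DecidableEq ι] {K : Type*} [Field K] [Algebra ℚ K]
    (b : Basis ι ℚ K) {τ : ι → K →+* ℂ} (hτ : Function.Injective τ) :
    IsUnit (Matrix.of fun c i => τ c (b i)) := by
  rw [← Matrix.linearIndependent_rows_iff_isUnit, Fintype.linearIndependent_iff]
  intro g hg
  have hind : LinearIndependent ℂ fun c => ((τ c : K →* ℂ) : K → ℂ) :=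
    (linearIndependent_monoidHom K ℂ).comp (fun c => (τ c : K →* ℂ)) fun c d h =>
      hτ (RingHom.ext fun x => DFunLike.congr_fun h x)
  refine Fintype.linearIndependent_iff.mp hind g (funext fun x => ?_)
  rw [Finset.sum_apply]
  change ∑ c, g c * τ c x = 0
  have hrow : ∀ i, ∑ c, g c * τ c (b i) = 0 := fun i => by
    simpa using congrFun hg i
  have hτq : ∀ c (q : ℚ) (y : K), τ c (q • y) = q • τ c y := fun c q y => map_rat_smul (τ c) q y
  rw [← b.sum_repr x]
  simp only [map_sum, hτq, Finset.mul_sum]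
  rw [Finset.sum_comm]
  refine Finset.sum_eq_zero fun i _ => ?_
  simp only [mul_smul_comm]
  rw [← Finset.smul_sum, hrow, smul_zero]

/-- Substituting the conjugates of a general combination of the basis is an invertible linear change
of variables: it keeps `Q` nonzero without raising its degree. A nonzero polynomial cannot vanish on
a grid with more points on each side than its degree. -/
theorem exists_nat_combination_eval_ne_zero [DecidableEq ι] {K : Type*} [Field K] [Algebra ℚ K]
    (b : Basis ι ℚ K) {τ : ι → K →+* ℂ} (hτ : Function.Injective τ) {Q : MvPolynomial ι ℂ}
    (hQ : Q ≠ 0) :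
    ∃ m : ι → ℕ, (∀ i, m i ≤ Q.totalDegree) ∧
      MvPolynomial.eval (fun c => τ c (∑ i, (m i : K) * b i)) Q ≠ 0 := by
  set M : Matrix ι ι ℂ := Matrix.of fun c i => τ c (b i) with hM
  let g : ι → MvPolynomial ι ℂ := fun c => ∑ i, MvPolynomial.C (τ c (b i)) * MvPolynomial.X i
  have hg : ∀ c, (g c).totalDegree ≤ 1 := fun c =>
    MvPolynomial.totalDegree_finsetSum_le fun i _ =>
      (MvPolynomial.totalDegree_mul _ _).trans (by simp)
  have heval : ∀ y, MvPolynomial.eval y (MvPolynomial.aeval g Q) =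
      MvPolynomial.eval (M.mulVec y) Q := by
    intro y
    rw [← MvPolynomial.coe_aeval_eq_eval, ← MvPolynomial.coe_aeval_eq_eval, RingHom.coe_coe,
      RingHom.coe_coe, ← AlgHom.comp_apply, MvPolynomial.comp_aeval]
    congr 2
    ext c
    simp [g, hM, Matrix.mulVec, dotProduct]
  have hne : MvPolynomial.aeval g Q ≠ 0 := by
    intro h0
    refine hQ (MvPolynomial.funext fun z => ?_)
    have hdet : IsUnit M.det := (Matrix.isUnit_iff_isUnit_det M).mp (isUnit_embeddings_matrix b hτ)
    have := heval (M⁻¹.mulVec z)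
    rw [Matrix.mulVec_mulVec, Matrix.mul_nonsing_inv M hdet, Matrix.one_mulVec, h0] at this
    rw [← this, map_zero, map_zero]
  by_contra! hcon
  refine hne (MvPolynomial.eq_zero_of_eval_zero_at_prod_finset _
    (fun _ => (Finset.range (Q.totalDegree + 1)).image (Nat.cast : ℕ → ℂ)) (fun i => ?_) ?_)
  · rw [Finset.card_image_of_injective _ Nat.cast_injective, Finset.card_range, Nat.lt_succ_iff]
    exact (MvPolynomial.degreeOf_le_totalDegree _ _).trans (totalDegree_aeval_le Q g hg)
  · intro x hx
    simp only [Finset.mem_image, Finset.mem_range, Nat.lt_succ_iff] at hx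
    choose m hm hmx using hx
    rw [heval, ← hcon m hm]
    congr 2
    ext c
    simp [hM, Matrix.mulVec, dotProduct, ← hmx, mul_comm]

/-- In a number field of degree `n` and discriminant `D`, there is an algebraic integer with
conjugates `O(|D| ^ (1 / n))` at which a given nonzero polynomial in the conjugates does not
vanish. -/
theorem exists_small_integer_eval_ne_zero [Nonempty ι] {Q : MvPolynomial ι ℂ} (hQ : Q ≠ 0) :
    ∃ C : ℝ, 0 < C ∧ ∀ (K : Type) [Field K] [NumberField K], finrank ℚ K = Fintype.card ι →
      ∀ τ : ι → K →+* ℂ, Function.Injective τ →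
        ∃ α : 𝓞 K, MvPolynomial.eval (fun c => τ c α) Q ≠ 0 ∧
          house (α : K) ^ Fintype.card ι ≤ C * |(discr K : ℝ)| := by
  classical
  obtain ⟨C, hC, h⟩ := exists_basis_house_pow_le (Fintype.card ι)
  set n := Fintype.card ι with hn
  refine ⟨(n * Q.totalDegree + 1 : ℝ) ^ n * C, by positivity, fun K _ _ hK τ hτ => ?_⟩
  obtain ⟨a', hlin', ha'⟩ := h K hK
  let e := Fintype.equivFin ι
  set a : ι → 𝓞 K := a' ∘ e with ha_def
  have hlin : LinearIndependent ℚ fun i => (a i : K) := hlin'.comp e e.injective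
  have ha : ∀ i, house (a i : K) ^ n ≤ C * |(discr K : ℝ)| := fun i => ha' (e i)
  let b := basisOfLinearIndependentOfCardEqFinrank hlin hK.symm
  have hb : ∀ i, b i = a i := fun i => by simp [b]
  obtain ⟨m, hm, hmQ⟩ := exists_nat_combination_eval_ne_zero b hτ hQ
  refine ⟨∑ i, (m i : 𝓞 K) * a i, by simpa [hb] using hmQ, ?_⟩
  obtain ⟨i₀, hi₀⟩ := Finite.exists_max fun i => house (a i : K)
  have hle : house ((∑ i, (m i : 𝓞 K) * a i : 𝓞 K) : K) ≤
      (n * Q.totalDegree + 1) * house (a i₀ : K) := by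
    have h1 : house ((∑ i, (m i : 𝓞 K) * a i : 𝓞 K) : K) ≤ ∑ i, house ((m i : K) * a i) := by
      simpa using house_sum_le_sum_house Finset.univ fun i => (m i : K) * a i
    have h2 : ∀ i ∈ Finset.univ, house ((m i : K) * a i) ≤ Q.totalDegree * house (a i₀ : K) := by
      intro i _
      rw [house_nat_mul]
      have := house_nonneg (a i : K)
      have := hi₀ i
      gcongr
      exact hm i
    have h3 := h1.trans (Finset.sum_le_card_nsmul _ _ _ h2)
    rw [Finset.card_univ, ← hn, nsmul_eq_mul, ← mul_assoc] at h3
    nlinarith [house_nonneg (a i₀ : K)]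
  calc _ ≤ ((n * Q.totalDegree + 1) * house (a i₀ : K)) ^ n :=
        pow_le_pow_left₀ (house_nonneg _) hle n
    _ ≤ _ := by
        rw [mul_pow, mul_assoc]
        exact mul_le_mul_of_nonneg_left (ha i₀) (by positivity)

end GeneralPosition

/-! ### Properties of the trace functions -/

section TraceProperties

open MvPolynomial

variable {G : Type*} [Group G] (H : Subgroup G)

theorem sum_expVector [Fintype (NormQuot H)] {k t : ℕ} {B : Finset (NormQuot H)}
    (hB : B ∈ pointedSubsets H k) : ∑ j, expVector H t B j = t + (k - 1) := by
  classical
  rw [← Finset.sum_subset (Finset.subset_univ B), ← Finset.add_sum_erase _ _ hB.2, ← hB.1,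
    ← Finset.card_erase_of_mem hB.2, Finset.card_eq_sum_ones]
  · congr 1
    · simp [expVector]
    · refine Finset.sum_congr rfl fun j hj => ?_
      rw [Finset.mem_erase] at hj
      simp [expVector, hj.1, hj.2]
  · intro j _ hj
    have h1 : j ≠ 1 := fun h => hj (h ▸ hB.2)
    simp [expVector, h1, hj]

attribute [local instance] Fintype.ofFinite

theorem cosetPerm_smul (j : NormQuot H) (g : G) (c : G ⧸ H) :
    cosetPerm H j (g • c) = g • cosetPerm H j c := by
  induction j using Quotient.inductionOn'
  induction c using Quotient.inductionOn'
  exact congrArg _ (mul_assoc _ _ _)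

variable [Finite G]

/-- Left translations commute with the permutations `π_j`, so they only permute the summands. -/
theorem rename_smul_traceFun (a : NormQuot H → ℕ) (g : G) :
    rename (fun c => g • c) (traceFun H a) = traceFun H a := by
  simp only [traceFun, map_sum, map_prod, map_pow, rename_X, ← cosetPerm_smul]
  exact Equiv.sum_comp (MulAction.toPerm g : Equiv.Perm (G ⧸ H))
    fun c => ∏ j, (X (cosetPerm H j c) : MvPolynomial (G ⧸ H) ℤ) ^ a j

theorem norm_aeval_traceFun_le (a : NormQuot H → ℕ) {x : G ⧸ H → ℂ} {r : ℝ}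
    (hx : ∀ c, ‖x c‖ ≤ r) :
    ‖aeval x (traceFun H a)‖ ≤ Nat.card (G ⧸ H) * r ^ ∑ j, a j := by
  simp only [traceFun, map_sum, map_prod, map_pow, aeval_X]
  refine (norm_sum_le _ _).trans ?_
  rw [Nat.card_eq_fintype_card, ← nsmul_eq_mul]
  refine Finset.sum_le_card_nsmul _ _ _ fun c _ => ?_
  rw [norm_prod, ← Finset.prod_pow_eq_pow_sum]
  refine Finset.prod_le_prod (fun _ _ => norm_nonneg _) fun j _ => ?_
  rw [norm_pow]
  exact pow_le_pow_left₀ (norm_nonneg _) (hx _) _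

end TraceProperties

/-! ### The counting argument -/

section CountingArgument

open MvPolynomial Module NumberField

/-- A value at the conjugates of an algebraic integer of a polynomial that is invariant under the
Galois group is a rational integer. -/
theorem exists_int_aeval_eq {ι L : Type*} [Field L] [Algebra ℚ L] [FiniteDimensional ℚ L]
    [IsGalois ℚ L] {y : ι → L} (hy : ∀ c, IsIntegral ℤ (y c)) {f : MvPolynomial ι ℤ}
    (π : (L ≃ₐ[ℚ] L) → ι → ι) (hπ : ∀ g c, g (y c) = y (π g c))
    (hf : ∀ g, rename (π g) f = f) : ∃ t : ℤ, aeval y f = (t : L) := by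
  have hfix : ∀ g : L ≃ₐ[ℚ] L, g (aeval y f) = aeval y f := by
    intro g
    conv_rhs => rw [← hf g, aeval_rename]
    rw [show y ∘ π g = fun c => g (y c) from funext fun c => (hπ g c).symm]
    have := (comp_aeval_apply (f := y) ((g : L →ₐ[ℚ] L).restrictScalars ℤ) f)
    simpa using this
  obtain ⟨q, hq⟩ := IntermediateField.mem_bot.mp ((IsGalois.mem_bot_iff_fixed _).mpr hfix)
  have hint : IsIntegral ℤ (aeval y f) := by
    rw [aeval_def, eval₂_eq]
    exact IsIntegral.sum _ fun d _ => (isIntegral_algebraMap).mul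
      (IsIntegral.prod _ fun c _ => (hy c).pow _)
  rw [← hq, isIntegral_algebraMap_iff (algebraMap ℚ L).injective] at hint
  obtain ⟨t, ht⟩ := IsIntegrallyClosed.isIntegral_iff.mp hint
  exact ⟨t, by rw [← hq, ← ht]; simp⟩

/-- The points `x`, with coordinates in an algebraic closure of `ℚ`, at which the values of
the polynomials `f i` are integers bounded by `B`, and the Jacobian determinant does not vanish. -/
def boundedPoints {ι : Type*} [Fintype ι] [DecidableEq ι] (f : ι → MvPolynomial ι ℤ) (B : ℝ) :
    Set (ι → AlgebraicClosure ℚ) :=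
  {x | (∃ t : ι → ℤ, (∀ i, |(t i : ℝ)| ≤ B) ∧ ∀ i, aeval x (f i) = (t i : AlgebraicClosure ℚ)) ∧
    aeval x (jacobianDet f) ≠ 0}

/-- There are at most `(2B + 1) ^ n ≤ (3B) ^ n` integer vectors, each with at most `M` nonsingular
preimages; an embedding into `ℂ` transfers the fibre bound. -/
theorem exists_ncard_boundedPoints_le {ι : Type*} [Fintype ι] [DecidableEq ι]
    (f : ι → MvPolynomial ι ℤ) :
    ∃ M : ℕ, ∀ B : ℝ, 1 ≤ B → (boundedPoints f B).Finite ∧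
      ((boundedPoints f B).ncard : ℝ) ≤ M * (3 * B) ^ Fintype.card ι := by
  classical
  obtain ⟨M, hM⟩ := exists_nonsingular_fibre_bound fun i => map (Int.castRingHom ℂ) (f i)
  refine ⟨M, fun B hB => ?_⟩
  have : Algebra.IsAlgebraic ℚ (AlgebraicClosure ℚ) := AlgebraicClosure.isAlgebraic ℚ
  let φ : AlgebraicClosure ℚ →ₐ[ℚ] ℂ := IsAlgClosed.lift
  let S : (ι → ℤ) → Set (ι → AlgebraicClosure ℚ) := fun t =>
    {x | (∀ i, aeval x (f i) = (t i : AlgebraicClosure ℚ)) ∧ aeval x (jacobianDet f) ≠ 0}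
  have hφ : ∀ (x : ι → AlgebraicClosure ℚ) (p : MvPolynomial ι ℤ),
      eval (φ ∘ x) (map (Int.castRingHom ℂ) p) = φ (aeval x p) := by
    intro x p
    rw [eval_map, ← algebraMap_int_eq, ← aeval_def]
    exact (comp_aeval_apply (f := x) (φ.restrictScalars ℤ) p).symm
  have hmaps : ∀ t : ι → ℤ, Set.MapsTo (fun x => φ ∘ x) (S t)
      {x : ι → ℂ | (∀ i, eval x (map (Int.castRingHom ℂ) (f i)) = (t i : ℂ)) ∧
        eval x (jacobianDet fun i => map (Int.castRingHom ℂ) (f i)) ≠ 0} := by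
    rintro t x ⟨hx, hJ⟩
    refine ⟨fun i => by rw [hφ, hx, map_intCast], ?_⟩
    rw [map_jacobianDet, hφ]
    simpa using hJ
  have hinj : Function.Injective fun x : ι → AlgebraicClosure ℚ => φ ∘ x :=
    φ.toRingHom.injective.comp_left
  have hSfin : ∀ t, (S t).Finite := fun t =>
    Set.Finite.of_injOn (hmaps t) hinj.injOn (hM _).1
  have hScard : ∀ t, (S t).ncard ≤ M := fun t =>
    (Set.ncard_le_ncard_of_injOn _ (hmaps t) hinj.injOn (hM _).1).trans (hM _).2
  let T : Finset (ι → ℤ) := Fintype.piFinset fun _ => Finset.Icc (-⌊B⌋) ⌊B⌋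
  have hsub : boundedPoints f B ⊆ (T.biUnion fun t => (hSfin t).toFinset : Finset _) := by
    rintro x ⟨⟨t, ht, hx⟩, hJ⟩
    rw [Finset.mem_coe, Finset.mem_biUnion]
    refine ⟨t, Fintype.mem_piFinset.mpr fun i => ?_, (hSfin t).mem_toFinset.mpr ⟨hx, hJ⟩⟩
    have h := abs_le.mp (ht i)
    rw [Finset.mem_Icc, Int.le_floor, neg_le, Int.le_floor]
    push_cast
    constructor <;> linarith
  refine ⟨(Finset.finite_toSet _).subset hsub, ?_⟩
  have h1 : (boundedPoints f B).ncard ≤ T.card * M := by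
    refine (Set.ncard_le_ncard hsub (Finset.finite_toSet _)).trans ?_
    rw [Set.ncard_coe_finset]
    refine Finset.card_biUnion_le_card_mul _ _ _ fun t _ => ?_
    rw [← Set.ncard_eq_toFinset_card _ (hSfin t)]
    exact hScard t
  have h2 : (T.card : ℝ) ≤ (3 * B) ^ Fintype.card ι := by
    rw [Fintype.card_piFinset, Finset.prod_const, Finset.card_univ, Nat.cast_pow, Int.card_Icc]
    refine pow_le_pow_left₀ (Nat.cast_nonneg _) ?_ _
    have h0 : 0 ≤ ⌊B⌋ := Int.floor_nonneg.mpr (by linarith)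
    have h3 := Int.floor_le B
    rw [← Int.cast_natCast, Int.toNat_of_nonneg (by omega)]
    push_cast
    linarith
  calc ((boundedPoints f B).ncard : ℝ) ≤ T.card * M := by exact_mod_cast h1
    _ ≤ (3 * B) ^ Fintype.card ι * M := by gcongr
    _ = _ := mul_comm _ _

end CountingArgument

/-! ### From fields to integral points, and the bound for transitive groups -/

section MainTheorem

open MvPolynomial Module NumberField MulAction

/-- For a transitive group, the cosets of the stabilizer of a point correspond to the points. -/
theorem bijective_ofQuotientStabilizer {G Ω : Type*} [Group G] [MulAction G Ω]
    [IsPretransitive G Ω] (ω : Ω) : Function.Bijective (ofQuotientStabilizer G ω) :=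
  ⟨injective_ofQuotientStabilizer G ω, fun y => by
    obtain ⟨g, hg⟩ := exists_smul_eq G ω y
    exact ⟨(g : G ⧸ stabilizer G ω), hg⟩⟩

/-- The polynomial whose nonvanishing at the conjugates of an algebraic number says that they are
distinct and that the Jacobian determinant does not vanish there. -/
def genericityPolynomial {ι : Type*} [Fintype ι] [DecidableEq ι] (f : ι → MvPolynomial ι ℤ) :
    MvPolynomial ι ℂ :=
  map (Int.castRingHom ℂ) (jacobianDet f) * ∏ p ∈ Finset.univ.offDiag, (X p.1 - X p.2)

theorem genericityPolynomial_ne_zero {ι : Type*} [Fintype ι] [DecidableEq ι]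
    {f : ι → MvPolynomial ι ℤ} (hf : jacobianDet f ≠ 0) : genericityPolynomial f ≠ 0 := by
  refine mul_ne_zero ?_ (Finset.prod_ne_zero_iff.mpr fun p hp => ?_)
  · rwa [Ne, map_eq_zero_iff _ (map_injective _ (Int.castRingHom ℂ).injective_int)]
  · rw [sub_ne_zero]
    exact fun h => (Finset.mem_offDiag.mp hp).2.2 (X_injective h)

/-- A number field with the given group is generated by a coordinate of a point with integral trace
functions, whose size is controlled by the discriminant. -/
theorem exists_boundedPoint_generator {Ω : Type*} [Finite Ω] (G : Subgroup (Equiv.Perm Ω))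
    [IsPretransitive G Ω] (ω : Ω) [Fintype (G ⧸ stabilizer G ω)]
    [DecidableEq (G ⧸ stabilizer G ω)]
    (f : (G ⧸ stabilizer G ω) → MvPolynomial (G ⧸ stabilizer G ω) ℤ) (d : ℕ)
    (hinv : ∀ i (g : G), rename (fun c => g • c) (f i) = f i)
    (hsize : ∀ i (x : (G ⧸ stabilizer G ω) → ℂ) (r : ℝ), (∀ c, ‖x c‖ ≤ r) →
      ‖aeval x (f i)‖ ≤ Fintype.card (G ⧸ stabilizer G ω) * r ^ d)
    (hJ : jacobianDet f ≠ 0) :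
    ∃ A : ℝ, 1 ≤ A ∧ ∀ X : ℝ, ∀ K ∈ fieldsWithGroup G X,
      ∃ x ∈ boundedPoints f ((A * X ^ d) ^ (1 / Fintype.card (G ⧸ stabilizer G ω) : ℝ)),
        ∃ c, K = IntermediateField.adjoin ℚ {x c} := by
  set n := Fintype.card (G ⧸ stabilizer G ω) with hn
  have hn0 : n ≠ 0 := Fintype.card_ne_zero
  obtain ⟨C, hC, hgen⟩ := exists_small_integer_eval_ne_zero (genericityPolynomial_ne_zero hJ)
  -- The added `1` gives `1 ≤ A`, which later ensures that the bound on the trace values is at least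
  -- `1`.
  refine ⟨(n : ℝ) ^ n * C ^ d + 1, by linarith [show 0 ≤ (n : ℝ) ^ n * C ^ d by positivity],
    fun X K hK => ?_⟩
  obtain ⟨hNF, hdeg, hdisc, φ, e, he⟩ := hK
  have : Algebra.IsAlgebraic ℚ (AlgebraicClosure ℚ) := AlgebraicClosure.isAlgebraic ℚ
  have : Normal ℚ (AlgebraicClosure ℚ) :=
    { splits' := fun x => IsAlgClosed.splits _ }
  have hgal : IsGalois ℚ (galoisClosure K) :=
    { to_isSeparable := inferInstance
      to_normal := normalClosure.normal ℚ K (AlgebraicClosure ℚ) }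
  have : FiniteDimensional ℚ (galoisClosure K) := inferInstance
  have hbij := bijective_ofQuotientStabilizer (G := G) ω
  -- The embeddings of `K`, indexed by cosets so that the Galois action becomes left translation.
  let s : (G ⧸ stabilizer G ω) → K →ₐ[ℚ] galoisClosure K :=
    fun c => e.symm (ofQuotientStabilizer G ω c)
  have hs : Function.Bijective s := e.symm.bijective.comp hbij
  have hsmul : ∀ (g : galoisClosure K ≃ₐ[ℚ] galoisClosure K) c (z : K),
      g (s c z) = s (φ g • c) z := by
    intro g c z
    have h1 : g.toAlgHom.comp (s c) = s (φ g • c) := by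
      rw [← e.injective.eq_iff, he]
      simp [s, ofQuotientStabilizer_smul]
    exact DFunLike.congr_fun h1 z
  have hcard : finrank ℚ K = n := by
    rw [hdeg, hn, ← Nat.card_eq_fintype_card, Nat.card_eq_of_bijective _ hbij]
  let ψ : galoisClosure K →ₐ[ℚ] ℂ :=
    (IsAlgClosed.lift : AlgebraicClosure ℚ →ₐ[ℚ] ℂ).comp (galoisClosure K).val
  let τ : (G ⧸ stabilizer G ω) → K →+* ℂ := fun c => (ψ.comp (s c)).toRingHom
  have hτ : Function.Injective τ := fun c c' h => hs.1 (AlgHom.ext fun z =>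
    ψ.toRingHom.injective (DFunLike.congr_fun h z))
  obtain ⟨α, hα, hαC⟩ := hgen K hcard τ hτ
  rw [genericityPolynomial, map_mul, map_prod] at hα
  obtain ⟨hαJ, hαd⟩ := mul_ne_zero_iff.mp hα
  rw [Finset.prod_ne_zero_iff] at hαd
  have hval : ∀ p : MvPolynomial (G ⧸ stabilizer G ω) ℤ,
      aeval (fun c => τ c α) p = ψ (aeval (fun c => s c α) p) := fun p =>
    (comp_aeval_apply (f := fun c => s c α) (ψ.restrictScalars ℤ) p).symm
  have hval' : ∀ p : MvPolynomial (G ⧸ stabilizer G ω) ℤ,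
      aeval (fun c => (s c α : AlgebraicClosure ℚ)) p = (aeval (fun c => s c α) p :) := fun p =>
    (comp_aeval_apply (f := fun c => s c α) ((galoisClosure K).val.restrictScalars ℤ) p).symm
  have hαint : ∀ c, IsIntegral ℤ (s c α) := fun c =>
    (RingOfIntegers.isIntegral_coe α).map ((s c).restrictScalars ℤ)
  choose t ht' using fun i => exists_int_aeval_eq hαint (fun g c => φ g • c)
    (fun g c => hsmul g c α) fun g => hinv i (φ g)
  have ht : ∀ i, aeval (fun c => s c α) (f i) = (t i : galoisClosure K) := fun i => by
    convert! ht' i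
  refine ⟨fun c => s c α, ⟨⟨t, fun i => ?_, fun i => ?_⟩, ?_⟩, ?_⟩
  · have h1 : ‖(t i : ℂ)‖ ≤ n * house (α : K) ^ d := by
      have := hsize i (fun c => τ c α) _ fun c => norm_embedding_le_house (α : K) (τ c)
      rwa [hval, ht, map_intCast] at this
    rw [Complex.norm_intCast] at h1
    have hX : 0 ≤ X := (abs_nonneg _).trans hdisc
    have h2 : |(t i : ℝ)| ^ n ≤ ((n : ℝ) ^ n * C ^ d + 1) * X ^ d := by
      have hh := house_nonneg (α : K)
      calc |(t i : ℝ)| ^ n ≤ (n * house (α : K) ^ d) ^ n :=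
            pow_le_pow_left₀ (abs_nonneg _) h1 n
        _ = (n : ℝ) ^ n * (house (α : K) ^ n) ^ d := by ring
        _ ≤ (n : ℝ) ^ n * (C * X) ^ d := by
            have := hαC.trans (mul_le_mul_of_nonneg_left hdisc hC.le)
            gcongr
        _ ≤ ((n : ℝ) ^ n * C ^ d + 1) * X ^ d := by
            rw [mul_pow, ← mul_assoc]
            gcongr
            linarith
    rw [one_div, Real.le_rpow_inv_iff_of_pos (abs_nonneg _) (by positivity) (by positivity),
      Real.rpow_natCast]
    exact h2
  · rw [hval', ht]
    simp
  · rw [hval']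
    rw [eval_map, ← algebraMap_int_eq, ← aeval_def, hval] at hαJ
    intro h0
    refine hαJ ?_
    rw [show aeval (fun c => s c (α : K)) (jacobianDet f) = 0 from Subtype.ext h0, map_zero]
  -- The coset of the identity embedding: its coordinate is `α` itself, which is primitive because
  -- its conjugates are distinct.
  · obtain ⟨c, hc⟩ := hs.2 (IntermediateField.inclusion K.le_normalClosure)
    refine ⟨c, ?_⟩
    have hinj : ∀ c', s c α = s c' α → c = c' := by
      intro c' h
      by_contra hne
      refine hαd (c, c') (Finset.mem_offDiag.mpr ⟨Finset.mem_univ _, Finset.mem_univ _, hne⟩) ?_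
      rw [map_sub, eval_X, eval_X, sub_eq_zero]
      exact congrArg ψ h
    have htop : IntermediateField.adjoin ℚ {(α : K)} = ⊤ := by
      rw [Field.primitive_element_iff_algHom_eq_of_eval ℚ (galoisClosure K) ?_ (α : K) (s c)]
      · intro σ hσ
        obtain ⟨c', rfl⟩ := hs.2 σ
        rw [hinj c' hσ]
      · intro z
        rw [← minpoly.algHom_eq (s c) (s c).injective z]
        exact hgal.to_normal.splits _
    change K = IntermediateField.adjoin ℚ {(s c (α : K) : AlgebraicClosure ℚ)}
    rw [hc]
    exact ((IntermediateField.lift_top ℚ K).symm.trans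
      (congrArg IntermediateField.lift htop.symm)).trans
        (IntermediateField.lift_adjoin_simple ℚ K (α : K))

/-- The bound for the number of fields with a given transitive group, in terms of trace
functions. -/
theorem exists_fieldCount_le {Ω : Type*} [Finite Ω] (G : Subgroup (Equiv.Perm Ω))
    [IsPretransitive G Ω] (ω : Ω) (k t : ℕ) (hD : JacobianCondition (stabilizer G ω) k t) :
    ∃ C : ℝ, 0 < C ∧ ∀ X : ℝ, 0 < X → (fieldsWithGroup G X).Finite ∧
      (fieldCount G X : ℝ) ≤ C * X ^ (t + (k - 1)) := by
  classical
  let : Fintype (G ⧸ stabilizer G ω) := Fintype.ofFinite _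
  obtain ⟨B, hB⟩ := hD
  set d := t + (k - 1) with hd
  set f := fun i => traceFun (stabilizer G ω) (expVector (stabilizer G ω) t (B i)) with hf
  have hJ : jacobianDet f ≠ 0 := by
    rw [jacobianDet]
    convert! hB
  set n := Fintype.card (G ⧸ stabilizer G ω) with hn
  have hn0 : n ≠ 0 := Fintype.card_ne_zero
  obtain ⟨A, hA, hfields⟩ := exists_boundedPoint_generator G ω f d
    (fun i g => rename_smul_traceFun _ _ g) (fun i x r hx => by
      let := Fintype.ofFinite (NormQuot (stabilizer G ω))
      have := norm_aeval_traceFun_le (stabilizer G ω) (expVector (stabilizer G ω) t (B i)) hx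
      rw [Nat.card_eq_fintype_card] at this
      convert! this
      exact (sum_expVector _ (B i).2).symm) hJ
  obtain ⟨M, hM⟩ := exists_ncard_boundedPoints_le f
  refine ⟨(M * (3 ^ n * A) * n + 1 : ℝ), by positivity, fun X hX => ?_⟩
  -- No field has `|D| < 1`; for `X ≥ 1` the box of integer vectors has side at least `1`.
  rcases lt_or_ge X 1 with hX1 | hX1
  · have hempty : fieldsWithGroup G X = ∅ := by
      rw [Set.eq_empty_iff_forall_notMem]
      rintro K ⟨_, -, hdisc, -⟩
      have h1 : (1 : ℝ) ≤ |(discr K : ℝ)| := by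
        exact_mod_cast Int.one_le_abs (discr_ne_zero K)
      linarith
    rw [fieldCount, hempty]
    exact ⟨Set.finite_empty, by simp; positivity⟩
  · set b : ℝ := (A * X ^ d) ^ (1 / n : ℝ) with hb
    have hAX : 1 ≤ A * X ^ d := one_le_mul_of_one_le_of_one_le hA (one_le_pow₀ hX1)
    have hb1 : 1 ≤ b := Real.one_le_rpow hAX (by positivity)
    have hbn : b ^ n = A * X ^ d := by
      rw [hb, one_div, Real.rpow_inv_natCast_pow (by linarith) hn0]
    obtain ⟨hfin, hcard⟩ := hM b hb1
    have hsub : fieldsWithGroup G X ⊆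
        (fun p : ((G ⧸ stabilizer G ω) → AlgebraicClosure ℚ) × (G ⧸ stabilizer G ω) =>
          IntermediateField.adjoin ℚ {p.1 p.2}) '' (boundedPoints f b ×ˢ Set.univ) := by
      intro K hK
      obtain ⟨x, hx, c, hc⟩ := hfields X K hK
      exact ⟨(x, c), ⟨hx, Set.mem_univ _⟩, hc.symm⟩
    have hpfin := hfin.prod (Set.finite_univ (α := G ⧸ stabilizer G ω))
    refine ⟨(hpfin.image _).subset hsub, ?_⟩
    have h1 : fieldCount G X ≤ (boundedPoints f b).ncard * n := by
      refine (Set.ncard_le_ncard hsub (hpfin.image _)).trans ((Set.ncard_image_le hpfin).trans ?_)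
      rw [Set.ncard_prod, Set.ncard_univ, Nat.card_eq_fintype_card]
    calc (fieldCount G X : ℝ) ≤ (boundedPoints f b).ncard * n := by exact_mod_cast h1
      _ ≤ M * (3 * b) ^ n * n := by gcongr
      _ = M * (3 ^ n * A) * n * X ^ d := by rw [mul_pow, hbn]; ring
      _ ≤ _ := by
        gcongr
        linarith

instance isPretransitive_productGroup {s : ℕ} (n : Fin (s + 1) → ℕ) :
    IsPretransitive (productGroup n) (Points n) where
  exists_smul_eq x y := by
    refine ⟨⟨naturalEmbedding n (Fin.snoc (α := fun i => Equiv.Perm (Fin (n i)))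
      (fun i => Equiv.swap (x.1 i) (y.1 i)) (y.2 * x.2⁻¹)), ⟨_, rfl⟩⟩, ?_⟩
    rw [Subgroup.smul_def, Equiv.Perm.smul_def, naturalEmbedding_apply]
    ext1
    · funext i
      simp
    · simp

end MainTheorem

end NumberFieldCount

end


theorem corollaryC (s : ℕ) (hs : 1 ≤ s) (n : Fin (s + 1) → ℕ) (hn : ∀ i, 2 ≤ n i)
    (ω : NumberFieldCount.Points n)
    (hl : (∏ i : Fin s, n i.castSucc) * (n (Fin.last s)).factorial
      ≤ ((n (Fin.last s)).factorial - 1).choose 2)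
    (hD : NumberFieldCount.JacobianCondition
      (MulAction.stabilizer (NumberFieldCount.productGroup n) ω) 3 2) :
    ∃ C : ℝ, 0 < C ∧ ∀ X : ℝ, 0 < X →
      (NumberFieldCount.fieldsWithGroup (NumberFieldCount.productGroup n) X).Finite ∧
      (NumberFieldCount.fieldCount (NumberFieldCount.productGroup n) X : ℝ) ≤ C * X ^ 4 :=
  -- Exponent `2` at the identity and `1` at two other cosets: the degree is `2 + (3 - 1) = 4`.
  NumberFieldCount.exists_fieldCount_le (NumberFieldCount.productGroup n) ω 3 2 hD
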